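/- Let $p : Y \to X$ be a finite regular cover of finite connected graphs with $Y$ connected, with deck group $G$. Fix a vertex $y_0$ of $Y$, put $x_0 = p(y_0)$, and let $\phi : \pi_1(X,x_0) \to G$ be the associated epimorphism: $\phi(l)$ is the deck transformation taking $y_0$ to the end point of the lift of $l$ starting at $y_0$. For $l \in \pi_1(X,x_0)$ let $k(l) \ge 1$ be the smallest positive integer with $l^{k(l)} \in \ker\phi$; the preferred elevation $\tilde l \in \pi_1(Y,y_0)$ of $l$ is the (closed) lift of $l^{k(l)}$ at $y_0$, and $[\tilde l] \in H_1(Y;\mathbb{C})$ is its homology class. The group $G$ acts linearly on $H_1(Y;\mathbb{C})$. Let $n \ge 2$, let $x_1,\dots,x_n$ be a free basis of $\pi_1(X,x_0)$, let $i \ne j$, and set $x_{ij} = [x_i,x_j]$, $K = \langle \phi(x_{ij})\rangle$ and $H = \langle \phi(x_i),\phi(x_j)\rangle$. Then $K \le H \le G$ and there is an isomorphism of $G$-representations $$\mathrm{Span}_{\mathbb{C}[G]}\{[\widetilde{x_{ij}}]\} \;\cong\; \mathrm{Ind}_K^G(\mathbb{C}_{\mathrm{triv}})/\mathrm{Ind}_H^G(\mathbb{C}_{\mathrm{triv}}),$$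 where $\mathbb{C}_{\mathrm{triv}}$ is the trivial one-dimensional representation and $\mathrm{Ind}_H^G(\mathbb{C}_{\mathrm{triv}})$ is regarded as a subrepresentation of $\mathrm{Ind}_K^G(\mathbb{C}_{\mathrm{triv}})$ through the canonical injection, induced from the map $\mathbb{C}_{\mathrm{triv}} \to \mathrm{Ind}_K^H(\mathbb{C}_{\mathrm{triv}}) = \mathbb{C}[H/K]$ that sends $1$ to the sum of all cosets of $K$ in $H$. -/

import Mathlib

/-- A graph (one-dimensional CW complex): vertices, edges, and for each edge its two end points.
Loops and multiple edges are allowed. Each edge carries an auxiliary orientation, from `src` to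
`tgt`; walks may traverse edges in both directions. -/
structure CWGraph.{u, v} where
  V : Type u
  E : Type v
  src : E → V
  tgt : E → V

namespace CWGraph

/-- Initial vertex of an oriented edge; `(e, true)` is `e` and `(e, false)` is `e` reversed. -/
def init (X : CWGraph) (a : X.E × Bool) : X.V := if a.2 then X.src a.1 else X.tgt a.1

/-- Terminal vertex of an oriented edge. -/
def term (X : CWGraph) (a : X.E × Bool) : X.V := if a.2 then X.tgt a.1 else X.src a.1

/-- `X.IsPath u L v`: the list `L` of oriented edges is an edge path from `u` to `v`. -/
def IsPath (X : CWGraph) : X.V → List (X.E × Bool) → X.V → Prop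
  | u, [], v => u = v
  | u, a :: L, v => X.init a = u ∧ IsPath X (X.term a) L v

theorem IsPath.append {X : CWGraph} {L M : List (X.E × Bool)} {u v w : X.V}
    (h : X.IsPath u L v) (h' : X.IsPath v M w) : X.IsPath u (L ++ M) w := by
  induction L generalizing u with
  | nil => cases h; exact h'
  | cons a L ih => exact ⟨h.1, ih h.2⟩

theorem IsPath.invRev {X : CWGraph} {L : List (X.E × Bool)} {u v : X.V}
    (h : X.IsPath u L v) : X.IsPath v (FreeGroup.invRev L) u := by
  induction L generalizing u with
  | nil => cases h; exact rfl
  | cons a L ih =>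
    rw [FreeGroup.invRev_cons]
    refine (ih h.2).append ?_
    obtain ⟨e, b⟩ := a
    cases b <;> exact ⟨rfl, h.1⟩

/-- A graph is connected if it is non-empty and any two vertices are joined by an edge path. -/
def Connected (X : CWGraph) : Prop :=
  Nonempty X.V ∧ ∀ u v : X.V, ∃ L, X.IsPath u L v

/-- The fundamental group of a graph at the vertex `x`: closed edge paths at `x` modulo insertion
and deletion of backtracks `a a⁻¹`. It is realised as the subgroup of the free group on all edges
consisting of the classes of closed edge paths at `x`. The product of two
classes is concatenation, the left factor being traversed first. -/
def pi1 (X : CWGraph) (x : X.V) : Subgroup (FreeGroup X.E) where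
  carrier := {w | ∃ L, X.IsPath x L x ∧ FreeGroup.mk L = w}
  one_mem' := ⟨[], rfl, rfl⟩
  mul_mem' := by
    rintro _ _ ⟨L, hL, rfl⟩ ⟨M, hM, rfl⟩
    exact ⟨L ++ M, hL.append hM, rfl⟩
  inv_mem' := by
    rintro _ ⟨L, hL, rfl⟩
    exact ⟨FreeGroup.invRev L, hL.invRev, FreeGroup.inv_mk.symm⟩

/-- The cellular boundary map `C₁(X; ℂ) → C₀(X; ℂ)`, sending an edge to `tgt - src`. -/
noncomputable def boundary (X : CWGraph) : (X.E →₀ ℂ) →ₗ[ℂ] (X.V →₀ ℂ) :=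
  Finsupp.lmapDomain ℂ ℂ X.tgt - Finsupp.lmapDomain ℂ ℂ X.src

/-- First homology with complex coefficients: a graph has no 2-cells, so it is the space
of 1-cycles. -/
noncomputable abbrev H1 (X : CWGraph) : Submodule ℂ (X.E →₀ ℂ) := LinearMap.ker X.boundary

/-- The homomorphism sending an edge path to the 1-chain it traverses. -/
noncomputable def chain (X : CWGraph) : FreeGroup X.E →* Multiplicative (X.E →₀ ℂ) :=
  FreeGroup.lift fun e => Multiplicative.ofAdd (Finsupp.single e 1)

theorem boundary_chain {X : CWGraph} {L : List (X.E × Bool)} {u v : X.V} (h : X.IsPath u L v) :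
    X.boundary (X.chain (FreeGroup.mk L)).toAdd = Finsupp.single v 1 - Finsupp.single u 1 := by
  induction L generalizing u with
  | nil => cases h; rw [← FreeGroup.one_eq_mk]; simp
  | cons a L ih =>
    have h1 : FreeGroup.mk (a :: L) = FreeGroup.mk [a] * FreeGroup.mk L := rfl
    rw [h1, map_mul, toAdd_mul, map_add, ih h.2]
    obtain ⟨h0, -⟩ := h
    obtain ⟨e, b⟩ := a
    subst h0
    cases b
    · simp only [chain, boundary, CWGraph.init, CWGraph.term, FreeGroup.lift_mk, List.map_cons,
        List.map_nil, List.prod_cons, List.prod_nil, cond_false, mul_one, toAdd_inv, toAdd_ofAdd,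
        map_neg, LinearMap.sub_apply, Finsupp.lmapDomain_apply, Finsupp.mapDomain_single,
        Bool.false_eq_true, if_false]
      abel
    · simp [chain, boundary, CWGraph.init, CWGraph.term]

/-- The homology class of an element of the fundamental group. -/
noncomputable def homologyClass (X : CWGraph) {x : X.V} (w : X.pi1 x) : X.H1 :=
  ⟨(X.chain w).toAdd, by
    obtain ⟨_, L, hL, rfl⟩ := w
    rw [LinearMap.mem_ker, boundary_chain hL, sub_self]⟩

end CWGraph

/-- A cover `Y → X` of connected graphs with `Y` connected.
The map sends vertices to vertices and edges to edges, compatibly with the orientations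
(the orientation of `Y` is the one pulled back from `X`), and it is a local isomorphism: each
edge of `X` issuing from (ending in) the image of a vertex `y` has exactly one lift issuing from
(ending in) `y`. -/
structure ConnectedCover (Y X : CWGraph) where
  onV : Y.V → X.V
  onE : Y.E → X.E
  src_onE : ∀ e, X.src (onE e) = onV (Y.src e)
  tgt_onE : ∀ e, X.tgt (onE e) = onV (Y.tgt e)
  existsUnique_src : ∀ y e, X.src e = onV y → ∃! e', Y.src e' = y ∧ onE e' = e
  existsUnique_tgt : ∀ y e, X.tgt e = onV y → ∃! e', Y.tgt e' = y ∧ onE e' = e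
  connected_base : X.Connected
  connected_total : Y.Connected

namespace ConnectedCover

/-- The deck group: automorphisms of the graph `Y` over `X` (permutations of the vertices and of
the edges), multiplied by composition of maps. -/
def Deck {Y X : CWGraph} (p : ConnectedCover Y X) :
    Subgroup (Equiv.Perm Y.V × Equiv.Perm Y.E) where
  carrier := {g | (∀ e, Y.src (g.2 e) = g.1 (Y.src e)) ∧ (∀ e, Y.tgt (g.2 e) = g.1 (Y.tgt e)) ∧
    (∀ v, p.onV (g.1 v) = p.onV v) ∧ (∀ e, p.onE (g.2 e) = p.onE e)}
  one_mem' := by simp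
  mul_mem' := by
    rintro a b ⟨h1, h2, h3, h4⟩ ⟨k1, k2, k3, k4⟩
    simp [h1, h2, h3, h4, k1, k2, k3, k4]
  inv_mem' := by
    rintro ⟨s, t⟩ ⟨h1, h2, h3, h4⟩
    refine ⟨fun e => ?_, fun e => ?_, fun v => ?_, fun e => ?_⟩
    · exact s.injective (by simpa using (h1 (t.symm e)).symm)
    · exact s.injective (by simpa using (h2 (t.symm e)).symm)
    · simpa using (h3 (s.symm v)).symm
    · simpa using (h4 (t.symm e)).symm

end ConnectedCover

/-- A connected cover is regular if its deck group acts transitively on every fibre. -/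
structure RegularCover (Y X : CWGraph) extends ConnectedCover Y X where
  regular : ∀ y y' : Y.V, onV y = onV y' → ∃ g : toConnectedCover.Deck, g.1.1 y = y'

namespace RegularCover

open CWGraph

section Lifting

variable {Y X : CWGraph} (p : RegularCover Y X)

/-- The image in `X` of a list of oriented edges of `Y`. -/
def proj (L : List (Y.E × Bool)) : List (X.E × Bool) := L.map fun a => (p.onE a.1, a.2)

theorem init_proj (a : Y.E × Bool) : X.init (p.onE a.1, a.2) = p.onV (Y.init a) := by
  unfold CWGraph.init; split <;> simp [p.src_onE, p.tgt_onE]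

theorem term_proj (a : Y.E × Bool) : X.term (p.onE a.1, a.2) = p.onV (Y.term a) := by
  unfold CWGraph.term; split <;> simp [p.src_onE, p.tgt_onE]

theorem isPath_proj {L : List (Y.E × Bool)} {u v : Y.V} (h : Y.IsPath u L v) :
    X.IsPath (p.onV u) (p.proj L) (p.onV v) := by
  induction L generalizing u with
  | nil => cases h; exact rfl
  | cons a L ih =>
    refine ⟨by rw [p.init_proj, h.1], ?_⟩
    rw [p.term_proj]
    exact ih h.2

theorem edge_lift (u : Y.V) (a : X.E × Bool) (h : X.init a = p.onV u) :
    ∃ c : Y.E × Bool, Y.init c = u ∧ (p.onE c.1, c.2) = a := by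
  obtain ⟨e, b⟩ := a
  cases b
  · obtain ⟨e', he, -⟩ := p.existsUnique_tgt u e h
    exact ⟨(e', false), he.1, by simp [he.2]⟩
  · obtain ⟨e', he, -⟩ := p.existsUnique_src u e h
    exact ⟨(e', true), he.1, by simp [he.2]⟩

theorem edge_lift_unique {a c : Y.E × Bool} (h : Y.init a = Y.init c)
    (h' : (p.onE a.1, a.2) = (p.onE c.1, c.2)) : a = c := by
  obtain ⟨e, b⟩ := a
  obtain ⟨e', b'⟩ := c
  simp only [Prod.mk.injEq] at h'
  obtain ⟨h1, rfl⟩ := h'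
  congr 1
  cases b
  · exact (p.existsUnique_tgt (Y.tgt e') (p.onE e') (p.tgt_onE e')).unique ⟨h, h1⟩ ⟨rfl, rfl⟩
  · exact (p.existsUnique_src (Y.src e') (p.onE e') (p.src_onE e')).unique ⟨h, h1⟩ ⟨rfl, rfl⟩

theorem path_lift {M : List (X.E × Bool)} {u : Y.V} {x : X.V} (h : X.IsPath (p.onV u) M x) :
    ∃ L v, Y.IsPath u L v ∧ p.proj L = M ∧ p.onV v = x := by
  induction M generalizing u with
  | nil => exact ⟨[], u, rfl, rfl, h⟩
  | cons a M ih =>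
    obtain ⟨c, hc, rfl⟩ := p.edge_lift u a h.1
    obtain ⟨L, v, hL, rfl, hv⟩ := ih (u := Y.term c) (by rw [← p.term_proj]; exact h.2)
    exact ⟨c :: L, v, ⟨hc, hL⟩, rfl, hv⟩

theorem path_lift_unique {L M : List (Y.E × Bool)} {u v w : Y.V} (hL : Y.IsPath u L v)
    (hM : Y.IsPath u M w) (h : p.proj L = p.proj M) : L = M ∧ v = w := by
  induction L generalizing u M with
  | nil =>
    cases M with
    | nil => exact ⟨rfl, hL.symm.trans hM⟩
    | cons b M => simp [proj] at h
  | cons a L ih =>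
    cases M with
    | nil => simp [proj] at h
    | cons b M =>
      simp only [proj, List.map_cons, List.cons.injEq] at h
      obtain rfl := p.edge_lift_unique (hL.1.trans hM.1.symm) h.1
      obtain ⟨rfl, rfl⟩ := ih hL.2 hM.2 h.2
      exact ⟨rfl, rfl⟩

theorem step_lift {L : List (Y.E × Bool)} {M : List (X.E × Bool)} {u v : Y.V}
    (hL : Y.IsPath u L v) (h : FreeGroup.Red.Step (p.proj L) M) :
    ∃ L', Y.IsPath u L' v ∧ p.proj L' = M ∧ FreeGroup.mk L' = FreeGroup.mk L := by
  induction L generalizing u M with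
  | nil => exact absurd h FreeGroup.Red.not_step_nil
  | cons a L ih =>
    rw [proj, List.map_cons, FreeGroup.Red.Step.cons_left_iff] at h
    rcases h with ⟨M', hM', rfl⟩ | h
    · obtain ⟨L', h1, rfl, h3⟩ := ih hL.2 hM'
      refine ⟨a :: L', ⟨hL.1, h1⟩, rfl, ?_⟩
      change FreeGroup.mk [a] * FreeGroup.mk L' = FreeGroup.mk [a] * FreeGroup.mk L
      rw [h3]
    · cases L with
      | nil => simp at h
      | cons c L =>
        simp only [List.map_cons, List.cons.injEq] at h
        obtain ⟨hc, rfl⟩ := h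
        have hca : c = (a.1, !a.2) := by
          refine p.edge_lift_unique ?_ hc
          rw [hL.2.1]
          obtain ⟨e, b⟩ := a
          cases b <;> rfl
        subst hca
        refine ⟨L, ?_, rfl, ?_⟩
        · have h2 := hL.2.2
          rw [← hL.1]
          obtain ⟨e, b⟩ := a
          cases b <;> exact h2
        · exact (Quot.sound FreeGroup.Red.Step.cons_not).symm

theorem red_lift {L : List (Y.E × Bool)} {M : List (X.E × Bool)} {u v : Y.V}
    (hL : Y.IsPath u L v) (h : FreeGroup.Red (p.proj L) M) :
    ∃ L', Y.IsPath u L' v ∧ p.proj L' = M ∧ FreeGroup.mk L' = FreeGroup.mk L := by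
  induction h with
  | refl => exact ⟨L, hL, rfl, rfl⟩
  | tail _ hs ih =>
    obtain ⟨L', h1, rfl, h3⟩ := ih
    obtain ⟨L'', k1, k2, k3⟩ := p.step_lift h1 hs
    exact ⟨L'', k1, k2, k3.trans h3⟩

/-- Homotopic paths have homotopic lifts with the same end point. -/
theorem homotopy_lift {L M : List (Y.E × Bool)} {u v w : Y.V} (hL : Y.IsPath u L v)
    (hM : Y.IsPath u M w) (h : FreeGroup.mk (p.proj L) = FreeGroup.mk (p.proj M)) :
    v = w ∧ FreeGroup.mk L = FreeGroup.mk M := by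
  obtain ⟨N, hN, hN'⟩ := FreeGroup.Red.exact.1 h
  obtain ⟨L', h1, h2, h3⟩ := p.red_lift hL hN
  obtain ⟨M', k1, k2, k3⟩ := p.red_lift hM hN'
  obtain ⟨rfl, rfl⟩ := p.path_lift_unique h1 k1 (h2.trans k2.symm)
  exact ⟨rfl, h3.symm.trans k3⟩

/-- The translate of a list of oriented edges by a deck transformation. -/
def translate (g : p.Deck) (L : List (Y.E × Bool)) : List (Y.E × Bool) :=
  L.map fun a => (g.1.2 a.1, a.2)

theorem isPath_translate (g : p.Deck) {L : List (Y.E × Bool)} {u v : Y.V} (h : Y.IsPath u L v) :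
    Y.IsPath (g.1.1 u) (p.translate g L) (g.1.1 v) := by
  induction L generalizing u with
  | nil => cases h; exact rfl
  | cons a L ih =>
    obtain ⟨e, b⟩ := a
    obtain ⟨h0, h1⟩ := h
    subst h0
    have := ih h1
    cases b
    · refine ⟨g.2.2.1 e, ?_⟩
      change Y.IsPath (Y.src (g.1.2 e)) _ _
      rw [g.2.1 e]; exact this
    · refine ⟨g.2.1 e, ?_⟩
      change Y.IsPath (Y.tgt (g.1.2 e)) _ _
      rw [g.2.2.1 e]; exact this

theorem proj_translate (g : p.Deck) (L : List (Y.E × Bool)) :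
    p.proj (p.translate g L) = p.proj L := by
  simp [proj, translate, g.2.2.2.2]

/-- A deck transformation is determined by the image of one vertex. -/
theorem deck_ext {g h : p.Deck} (y : Y.V) (hy : g.1.1 y = h.1.1 y) : g = h := by
  have hV : ∀ v, g.1.1 v = h.1.1 v := fun v => by
    obtain ⟨L, hL⟩ := p.connected_total.2 y v
    have h1 := p.isPath_translate g hL
    rw [hy] at h1
    exact (p.path_lift_unique h1 (p.isPath_translate h hL)
      (by rw [proj_translate, proj_translate])).2
  refine Subtype.ext (Prod.ext (Equiv.ext hV) (Equiv.ext fun e => ?_))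
  have : ((g.1.2 e, true) : Y.E × Bool) = (h.1.2 e, true) := by
    refine p.edge_lift_unique ?_ ?_
    · change Y.src _ = Y.src _
      rw [g.2.1, h.2.1, hV]
    · simp [g.2.2.2.2, h.2.2.2.2]
  exact congrArg Prod.fst this

theorem exists_deck (y₀ : Y.V) (w : X.pi1 (p.onV y₀)) :
    ∃ g : p.Deck, ∃ L, Y.IsPath y₀ L (g.1.1 y₀) ∧ FreeGroup.mk (p.proj L) = w := by
  obtain ⟨_, M, hM, rfl⟩ := w
  obtain ⟨L, v, hL, rfl, hv⟩ := p.path_lift hM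
  obtain ⟨g, rfl⟩ := p.regular y₀ v hv.symm
  exact ⟨g, L, hL, rfl⟩

theorem deck_unique {y₀ : Y.V} {g h : p.Deck} {L M : List (Y.E × Bool)}
    (hL : Y.IsPath y₀ L (g.1.1 y₀)) (hM : Y.IsPath y₀ M (h.1.1 y₀))
    (e : FreeGroup.mk (p.proj L) = FreeGroup.mk (p.proj M)) : g = h :=
  p.deck_ext y₀ (p.homotopy_lift hL hM e).1

end Lifting

/-- The epimorphism `φ : π₁(X, x₀) → G` onto the deck group associated to the regular cover with
base point `y₀` over `x₀`: `φ w` is the (unique) deck transformation taking `y₀` to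
the end point of the lift of `w` starting at `y₀`. -/
noncomputable def phi {Y X : CWGraph} (p : RegularCover Y X) (y₀ : Y.V) :
    X.pi1 (p.onV y₀) →* p.Deck :=
  MonoidHom.mk' (fun w => (p.exists_deck y₀ w).choose) (by
    intro a b
    obtain ⟨L, hL, hL'⟩ := (p.exists_deck y₀ a).choose_spec
    obtain ⟨M, hM, hM'⟩ := (p.exists_deck y₀ b).choose_spec
    obtain ⟨N, hN, hN'⟩ := (p.exists_deck y₀ (a * b)).choose_spec
    refine p.deck_unique hN (hL.append (p.isPath_translate _ hM)) ?_
    have key : ∀ A B : List (Y.E × Bool), FreeGroup.mk (p.proj (A ++ B)) =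
        FreeGroup.mk (p.proj A) * FreeGroup.mk (p.proj B) := by
      intro A B; simp [proj]
    rw [hN', key, proj_translate, hL', hM']; rfl)

theorem phi_spec {Y X : CWGraph} (p : RegularCover Y X) (y₀ : Y.V) (w : X.pi1 (p.onV y₀)) :
    ∃ L, Y.IsPath y₀ L ((p.phi y₀ w).1.1 y₀) ∧ FreeGroup.mk (p.proj L) = w :=
  (p.exists_deck y₀ w).choose_spec

/-- The smallest `k ≥ 1` with `l ^ k ∈ ker φ`. -/
noncomputable def elevationDegree {Y X : CWGraph} (p : RegularCover Y X) (y₀ : Y.V)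
    (l : X.pi1 (p.onV y₀)) : ℕ :=
  sInf {k : ℕ | 0 < k ∧ l ^ k ∈ (p.phi y₀).ker}

theorem exists_elevation {Y X : CWGraph} (p : RegularCover Y X) (y₀ : Y.V)
    (l : X.pi1 (p.onV y₀)) :
    ∃ w : Y.pi1 y₀, FreeGroup.map p.onE (w : FreeGroup Y.E) =
      (l : FreeGroup X.E) ^ p.elevationDegree y₀ l := by
  have hk : l ^ p.elevationDegree y₀ l ∈ (p.phi y₀).ker := by
    rcases Set.eq_empty_or_nonempty {k : ℕ | 0 < k ∧ l ^ k ∈ (p.phi y₀).ker} with h | h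
    · rw [elevationDegree, h, Nat.sInf_empty, pow_zero]
      exact one_mem _
    · exact (Nat.sInf_mem h).2
  obtain ⟨L, hL, hL'⟩ := p.phi_spec y₀ (l ^ p.elevationDegree y₀ l)
  rw [MonoidHom.mem_ker.1 hk] at hL
  exact ⟨⟨FreeGroup.mk L, L, hL, rfl⟩, by simpa [proj] using hL'⟩

/-- The preferred elevation of `l`: the lift at `y₀` of the power `l ^ k`, where `k ≥ 1`
is minimal such that this lift is closed. It is the unique element of `π₁(Y, y₀)` that
the cover maps to `l ^ k`. -/
noncomputable def elevation {Y X : CWGraph} (p : RegularCover Y X) (y₀ : Y.V)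
    (l : X.pi1 (p.onV y₀)) : Y.pi1 y₀ :=
  (p.exists_elevation y₀ l).choose

/-- The action of the deck group on `C₁(Y; ℂ)` by permuting edges. -/
noncomputable def chainRep {Y X : CWGraph} (p : RegularCover Y X) :
    Representation ℂ p.Deck (Y.E →₀ ℂ) where
  toFun g := Finsupp.lmapDomain ℂ ℂ g.1.2
  map_one' := by ext; simp
  map_mul' g h := by ext; simp

theorem boundary_chainRep {Y X : CWGraph} (p : RegularCover Y X) (g : p.Deck) (c : Y.E →₀ ℂ) :
    Y.boundary (p.chainRep g c) = Finsupp.lmapDomain ℂ ℂ g.1.1 (Y.boundary c) := by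
  induction c using Finsupp.induction_linear with
  | zero => simp
  | add a b ha hb => simp only [map_add, ha, hb]
  | single e r => 
    have h (a b : Y.V →₀ ℂ) : Finsupp.mapDomain g.1.1 (a - b) =
        Finsupp.mapDomain g.1.1 a - Finsupp.mapDomain g.1.1 b :=
      map_sub (Finsupp.lmapDomain ℂ ℂ g.1.1) a b
    simp [boundary, chainRep, g.2.1, g.2.2.1, Finsupp.mapDomain_single, h]

/-- The representation of the deck group on `H₁(Y; ℂ)`. -/
noncomputable def homologyRep {Y X : CWGraph} (p : RegularCover Y X) :
    Representation ℂ p.Deck Y.H1 :=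
  p.chainRep.subrepresentation Y.H1 fun g c hc => by
    rw [Submodule.mem_comap, LinearMap.mem_ker, boundary_chainRep, LinearMap.mem_ker.1 hc, map_zero]

end RegularCover

namespace Representation

/-- The `ℂ[G]`-span of a vector `v`, as a subrepresentation: the linear span of the orbit. -/
noncomputable def orbitSpan {G W : Type*} [Group G] [AddCommGroup W] [Module ℂ W]
    (ρ : Representation ℂ G W) (v : W) : Subrepresentation ρ where
  toSubmodule := Submodule.span ℂ (Set.range fun g => ρ g v)
  apply_mem_toSubmodule g w hw := by
    induction hw using Submodule.span_induction with
    | mem x hx =>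
      obtain ⟨h, rfl⟩ := hx
      exact Submodule.subset_span ⟨g * h, by simp⟩
    | zero => simp
    | add x y _ _ hx hy => rw [map_add]; exact add_mem hx hy
    | smul a x _ hx => rw [map_smul]; exact Submodule.smul_mem _ a hx

/-- `Ind_K^G(ℂ_triv)`, the representation induced from the trivial representation of `K`.
It is spanned by the vectors `⟦x ⊗ 1⟧` for `x ∈ G`; these satisfy `⟦k x ⊗ 1⟧ = ⟦x ⊗ 1⟧` for
`k ∈ K`, and `g ∈ G` acts by `⟦x ⊗ 1⟧ ↦ ⟦x g⁻¹ ⊗ 1⟧`. -/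
noncomputable abbrev indTriv {G : Type*} [Group G] (K : Subgroup G) :
    Representation ℂ G (IndV K.subtype (trivial ℂ K ℂ)) :=
  ind K.subtype (trivial ℂ K ℂ)

/-- The vector `∑ h ∈ H, ⟦h x ⊗ c⟧` of `Ind_K^G(ℂ_triv)`, as a linear function of `c`. -/
noncomputable def indTrivSum {G : Type*} [Group G] [Finite G] (K H : Subgroup G) (x : G) :
    ℂ →ₗ[ℂ] IndV K.subtype (trivial ℂ K ℂ) :=
  letI := Fintype.ofFinite H
  ∑ h : H, IndV.mk K.subtype (trivial ℂ K ℂ) (h * x)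

theorem indTrivSum_mul {G : Type*} [Group G] [Finite G] (K H : Subgroup G) (g : H) (x : G) :
    indTrivSum K H (g * x) = indTrivSum K H x := by
  let := Fintype.ofFinite H
  exact Fintype.sum_equiv (Equiv.mulRight g) _ _ fun h => by simp [mul_assoc]

/-- The canonical embedding `Ind_H^G(ℂ_triv) → Ind_K^G(ℂ_triv)` for `K ≤ H`, induced from the
`H`-map `ℂ_triv → Ind_K^H(ℂ_triv)` that sends `1` to (a positive multiple of) the sum of all cosets:
`⟦x ⊗ c⟧ ↦ ∑ h ∈ H, ⟦h x ⊗ c⟧`, which is `|K|` times the sum over representatives `h` of `K \ H`. -/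
noncomputable def indTrivMap {G : Type*} [Group G] [Finite G] (K H : Subgroup G) :
    IntertwiningMap (indTriv H) (indTriv K) where
  toLinearMap := Coinvariants.lift _
    (TensorProduct.lift (Finsupp.linearCombination ℂ (indTrivSum K H) ∘ₗ
      (MonoidAlgebra.coeffLinearEquiv ℂ).toLinearMap)) (by
    intro g
    ext x
    simpa using congrArg (fun f => f 1) (indTrivSum_mul K H g x))
  isIntertwining' g := by
    ext x
    simp [indTrivSum, mul_assoc]

theorem indTrivMap_mk {G : Type*} [Group G] [Finite G] (K H : Subgroup G) (x : G) (c : ℂ) :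
    letI := Fintype.ofFinite H
    indTrivMap K H (IndV.mk H.subtype (trivial ℂ H ℂ) x c) =
      ∑ h : H, IndV.mk K.subtype (trivial ℂ K ℂ) (h * x) c := by
  change Finsupp.linearCombination ℂ (indTrivSum K H) (Finsupp.single x 1) c = _
  simp [indTrivSum]

end Representation

open scoped commutatorElement

/-! Write `s = x i`, `t = x j`, `a = φ(s)`, `b = φ(t)`, `g = φ([s,t])`, and let `v` be the class of
the elevation. Once `K` is known to fix `v`, the map `x ⊗ c ↦ c x⁻¹ v` sends `Ind_K^G` onto the span
of the orbit of `v`, and the point is that its kernel is the image of `Ind_H^G`.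

The chain `λ(w)` of the lift of `w` at `y₀` is a crossed homomorphism (`liftChain_mul`), so Fox
calculus (`crossedHom_commutator_pow`) gives `v = ∑_{m<k} g^m ((a - 1) λ(t) - (b - 1) λ(s))`. From
this formula `K` fixes `v`, and the norm element of `H` kills `v`; hence the image of `Ind_H^G` lies
in the kernel.

Conversely, let `∑ f(x) x⁻¹ v = 0` with `f` left `K`-invariant. Every crossed homomorphism on
`π₁(X)` factors through `λ` by a `G`-map on `C₁(Y)` (`exists_intertwiningMap`), and freeness allows
any values on the basis (`FreeGroupBasis.exists_crossedHom`). With values in `ℂ[G]`, sending `t` to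
`1` and the other basis elements to `0`, the relation becomes `k ∑ f(x) x⁻¹ (a - 1) = 0`, so `f(a x)
= f(x)`. Exchanging the roles of `s` and `t` gives invariance under `b`, hence under `H`. -/

open scoped commutatorElement

/-! ### Representations induced from the trivial one. -/

namespace Representation

section Induced

variable {G W : Type*} [Group G] [AddCommGroup W] [Module ℂ W]

/-- The vector `⟦x ⊗ c⟧` of `Ind_K^G(ℂ_triv)` only depends on the coset `K x`. -/
theorem indTriv_mk_mul (K : Subgroup G) {k : G} (hk : k ∈ K) (x : G) (c : ℂ) :
    IndV.mk K.subtype (trivial ℂ K ℂ) (k * x) c = IndV.mk K.subtype (trivial ℂ K ℂ) x c := by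
  have := Coinvariants.mk_self_apply
    (tprod ((leftRegular ℂ G).comp K.subtype) (trivial ℂ K ℂ)) ⟨k, hk⟩
    (TensorProduct.mk ℂ _ _ (.single x 1) c)
  simpa using this

/-- The intertwining map `Ind_K^G(ℂ_triv) → W`, `⟦x ⊗ c⟧ ↦ c x⁻¹ v`, given by a `K`-fixed
vector `v`. -/
noncomputable def indTrivLift (K : Subgroup G) (ρ : Representation ℂ G W) (v : W)
    (hv : ∀ k ∈ K, ρ k v = v) : IntertwiningMap (indTriv K) ρ where
  toLinearMap := Coinvariants.lift _
    (TensorProduct.lift (Finsupp.linearCombination ℂ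
      (fun x => (LinearMap.id : ℂ →ₗ[ℂ] ℂ).smulRight (ρ x⁻¹ v)) ∘ₗ
      (MonoidAlgebra.coeffLinearEquiv ℂ).toLinearMap)) (by
    rintro ⟨g, hg⟩
    ext x
    simp [hv _ (inv_mem hg)])
  isIntertwining' g := by
    ext x
    simp

theorem indTrivLift_mk (K : Subgroup G) (ρ : Representation ℂ G W) (v : W)
    (hv : ∀ k ∈ K, ρ k v = v) (x : G) (c : ℂ) :
    indTrivLift K ρ v hv (IndV.mk K.subtype (trivial ℂ K ℂ) x c) = c • ρ x⁻¹ v := by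
  change Finsupp.linearCombination ℂ
    (fun x => (LinearMap.id : ℂ →ₗ[ℂ] ℂ).smulRight (ρ x⁻¹ v)) (Finsupp.single x 1) c = _
  simp

theorem exists_eq_sum_indTriv_mk [Fintype G] (K : Subgroup G)
    (w : IndV K.subtype (trivial ℂ K ℂ)) :
    ∃ f : G → ℂ, w = ∑ x, IndV.mk K.subtype (trivial ℂ K ℂ) x (f x) := by
  induction w using Coinvariants.induction_on with
  | h t =>
    induction t using TensorProduct.induction_on with
    | zero => exact ⟨0, by simp⟩
    | add s t hs ht =>
      obtain ⟨f, hf⟩ := hs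
      obtain ⟨g, hg⟩ := ht
      exact ⟨f + g, by simp only [map_add, hf, hg, Pi.add_apply, Finset.sum_add_distrib]⟩
    | tmul s c =>
      induction s using MonoidAlgebra.induction_linear with
      | zero => exact ⟨0, by simp⟩
      | add s t hs ht =>
        obtain ⟨f, hf⟩ := hs
        obtain ⟨g, hg⟩ := ht
        exact ⟨f + g, by
          simp only [map_add, TensorProduct.add_tmul, hf, hg, Pi.add_apply,
            Finset.sum_add_distrib]⟩
      | single x r =>
        classical
        refine ⟨Pi.single x (r * c), ?_⟩
        rw [Finset.sum_eq_single x (fun y _ hy => by rw [Pi.single_eq_of_ne hy, map_zero])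
          (by simp), Pi.single_eq_same]
        change Coinvariants.mk _ _ = Coinvariants.mk _ (TensorProduct.tmul _ _ _)
        rw [← smul_eq_mul, ← TensorProduct.smul_tmul, MonoidAlgebra.smul_single, smul_eq_mul,
          mul_one]

/-- Every vector of `Ind_K^G(ℂ_triv)` is `∑ x, ⟦x ⊗ f x⟧` for a left `K`-invariant `f`. -/
theorem exists_invariant_eq_sum_indTriv_mk [Fintype G] (K : Subgroup G)
    (w : IndV K.subtype (trivial ℂ K ℂ)) :
    ∃ f : G → ℂ, (∀ k ∈ K, ∀ x, f (k * x) = f x) ∧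
      w = ∑ x, IndV.mk K.subtype (trivial ℂ K ℂ) x (f x) := by
  have := Fintype.ofFinite K
  obtain ⟨f, rfl⟩ := exists_eq_sum_indTriv_mk K w
  -- Averaging the coefficients over `K` does not change the vector, because `⟦k x ⊗ c⟧ = ⟦x ⊗ c⟧`.
  refine ⟨fun x => (Fintype.card K : ℂ)⁻¹ * ∑ k : K, f (k * x), fun k hk x => ?_, ?_⟩
  · exact congrArg _ (Fintype.sum_equiv (Equiv.mulRight (⟨k, hk⟩ : K)) _ _ fun h => by
      simp [mul_assoc])
  · have h (k : K) : ∑ x, IndV.mk K.subtype (trivial ℂ K ℂ) x (f (k * x)) =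
        ∑ x, IndV.mk K.subtype (trivial ℂ K ℂ) x (f x) :=
      Fintype.sum_equiv (Equiv.mulLeft (k : G)) _ _ fun x => by
        rw [Equiv.coe_mulLeft, indTriv_mk_mul K k.2]
    simp_rw [← smul_eq_mul (_⁻¹), map_smul, ← Finset.smul_sum, map_sum]
    rw [Finset.sum_comm, Finset.sum_congr rfl fun k _ => h k, Finset.sum_const, Finset.card_univ, ← Nat.cast_smul_eq_nsmul ℂ, smul_smul,
      inv_mul_cancel₀ (Nat.cast_ne_zero.2 Fintype.card_ne_zero), one_smul]

/-- An invariant vector `∑ x, ⟦x ⊗ f x⟧` lies in the image of `Ind_H^G(ℂ_triv)` as soon as `f` is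
left `H`-invariant. -/
theorem sum_indTriv_mk_mem_range [Fintype G] (K H : Subgroup G) (f : G → ℂ)
    (hf : ∀ h ∈ H, ∀ x, f (h * x) = f x) :
    ∑ x, IndV.mk K.subtype (trivial ℂ K ℂ) x (f x) ∈ (indTrivMap K H).range.toSubmodule := by
  let := Fintype.ofFinite H
  -- The embedding sums over `H`, not over cosets; for invariant `f` each of the `|H|` translates
  -- contributes the same vector, whence the normalisation.
  refine ⟨(Fintype.card H : ℂ)⁻¹ • ∑ x, IndV.mk H.subtype (trivial ℂ H ℂ) x (f x), ?_⟩
  rw [map_smul, map_sum]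
  have h1 (x : G) := indTrivMap_mk K H x (f x)
  simp only [IntertwiningMap.toLinearMap_apply, h1]
  rw [Finset.sum_comm]
  have h (k : H) : ∑ x, IndV.mk K.subtype (trivial ℂ K ℂ) (k * x) (f x) =
      ∑ x, IndV.mk K.subtype (trivial ℂ K ℂ) x (f x) :=
    Fintype.sum_equiv (Equiv.mulLeft (k : G)) _ _ fun x => by
      rw [Equiv.coe_mulLeft, hf k k.2]
  rw [Finset.sum_congr rfl fun k _ => h k, Finset.sum_const, Finset.card_univ, ← Nat.cast_smul_eq_nsmul ℂ, smul_smul,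
    inv_mul_cancel₀ (Nat.cast_ne_zero.2 Fintype.card_ne_zero), one_smul]

/-- Since `K ≤ H`, the vector `⟦1 ⊗ 1⟧` of `Ind_H^G` is fixed by `K` and so defines a map back from
`Ind_K^G`. The composite on `Ind_H^G` is multiplication by `|H| ≠ 0`. -/
theorem indTrivMap_injective [Finite G] {K H : Subgroup G} (hKH : K ≤ H) :
    Function.Injective (indTrivMap K H) := by
  let := Fintype.ofFinite H
  have hv : ∀ k ∈ K, indTriv H k (IndV.mk H.subtype (trivial ℂ H ℂ) 1 1) =
      IndV.mk H.subtype (trivial ℂ H ℂ) 1 1 := fun k hk => by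
    rw [ind_mk, one_mul, ← mul_one k⁻¹, indTriv_mk_mul H (inv_mem (hKH hk))]
  have key : (indTrivLift K (indTriv H) _ hv).toLinearMap ∘ₗ (indTrivMap K H).toLinearMap =
      (Fintype.card H : ℂ) • LinearMap.id := by
    refine IndV.hom_ext _ _ fun x => LinearMap.ext_ring ?_
    have h1 := indTrivMap_mk K H x 1
    have h2 (h : H) : indTrivLift K (indTriv H) _ hv
        (IndV.mk K.subtype (trivial ℂ K ℂ) (h * x) 1) = IndV.mk H.subtype (trivial ℂ H ℂ) x 1 := by
      rw [indTrivLift_mk, one_smul, ind_mk, one_mul, inv_inv, indTriv_mk_mul H h.2]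
    change indTrivLift K (indTriv H) _ hv (indTrivMap K H _) = _
    rw [h1, map_sum, Finset.sum_congr rfl fun h _ => h2 h, Finset.sum_const, Finset.card_univ,
      ← Nat.cast_smul_eq_nsmul ℂ]
    rfl
  intro s t hst
  have h2 := congrArg (indTrivLift K (indTriv H) _ hv) hst
  have h3 (w) : indTrivLift K (indTriv H) _ hv (indTrivMap K H w) = (Fintype.card H : ℂ) • w :=
    LinearMap.congr_fun key w
  rw [h3, h3] at h2
  exact smul_right_injective _ (Nat.cast_ne_zero.2 (Fintype.card_ne_zero (α := H))) h2

theorem range_indTrivLift (K : Subgroup G) (ρ : Representation ℂ G W) (v : W)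
    (hv : ∀ k ∈ K, ρ k v = v) :
    LinearMap.range (indTrivLift K ρ v hv).toLinearMap = (ρ.orbitSpan v).toSubmodule := by
  apply le_antisymm
  · rw [LinearMap.range_eq_map, Submodule.map_le_iff_le_comap]
    rintro w -
    induction w using Coinvariants.induction_on with
    | h t =>
      induction t using TensorProduct.induction_on with
      | zero => simp
      | add s t hs ht => rw [map_add]; exact add_mem hs ht
      | tmul s c =>
        induction s using MonoidAlgebra.induction_linear with
        | zero => simp
        | add s t hs ht => rw [TensorProduct.add_tmul, map_add]; exact add_mem hs ht
        | single x r =>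
          have : Coinvariants.mk (tprod ((leftRegular ℂ G).comp K.subtype) (trivial ℂ K ℂ))
              (TensorProduct.tmul ℂ (MonoidAlgebra.single x r) c) =
              IndV.mk K.subtype (trivial ℂ K ℂ) x (r * c) := by
            change _ = Coinvariants.mk _ (TensorProduct.tmul _ _ _)
            rw [← smul_eq_mul r c, ← TensorProduct.smul_tmul, MonoidAlgebra.smul_single,
              smul_eq_mul, mul_one]
          rw [this, Submodule.mem_comap, IntertwiningMap.toLinearMap_apply, indTrivLift_mk]
          exact Submodule.smul_mem _ _ (Submodule.subset_span ⟨_, rfl⟩)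
  · refine Submodule.span_le.2 ?_
    rintro _ ⟨g, rfl⟩
    refine ⟨IndV.mk K.subtype (trivial ℂ K ℂ) g⁻¹ 1, ?_⟩
    rw [IntertwiningMap.toLinearMap_apply, indTrivLift_mk, inv_inv, one_smul]

/-- If `v` is fixed by `K`, killed by the norm element of `H`, and its annihilator consists
of `H`-invariant elements, then its orbit span is `Ind_K^G(ℂ_triv) / Ind_H^G(ℂ_triv)`. -/
theorem nonempty_orbitSpan_equiv [Fintype G] (K H : Subgroup G) [Fintype H]
    (ρ : Representation ℂ G W) (v : W)
    (hv : ∀ k ∈ K, ρ k v = v) (hsum : ∑ h : H, ρ h v = 0)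
    (hker : ∀ f : G → ℂ, (∀ k ∈ K, ∀ x, f (k * x) = f x) → ∑ x, f x • ρ x⁻¹ v = 0 →
      ∀ h ∈ H, ∀ x, f (h * x) = f x) :
    Nonempty (Representation.Equiv (ρ.orbitSpan v).toRepresentation
      ((indTriv K).quotient (indTrivMap K H).range.toSubmodule
        (indTrivMap K H).range.apply_mem_toSubmodule)) := by
  set T := indTrivLift K ρ v hv with hT
  -- `T` sends `∑ h, ⟦h x ⊗ 1⟧` to `x⁻¹ ∑ h⁻¹ v`, which vanishes by `hsum`. Conversely, a kernel
  -- vector has `K`-invariant coefficients after averaging, and `hker` makes them `H`-invariant.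
  have hk : (indTrivMap K H).range.toSubmodule = LinearMap.ker T.toLinearMap := by
    apply le_antisymm
    · have : T.toLinearMap ∘ₗ (indTrivMap K H).toLinearMap = 0 := by
        refine IndV.hom_ext _ _ fun x => LinearMap.ext_ring ?_
        have h1 := indTrivMap_mk K H x 1
        rw [Subsingleton.elim (Fintype.ofFinite H) ‹_›] at h1
        have h2 (h : H) : T (IndV.mk K.subtype (trivial ℂ K ℂ) (h * x) 1) =
            ρ x⁻¹ (ρ (h⁻¹ : H) v) := by
          rw [hT, indTrivLift_mk, one_smul, mul_inv_rev, map_mul]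
          rfl
        change T (indTrivMap K H _) = 0
        rw [h1, map_sum, Finset.sum_congr rfl fun h _ => h2 h, ← map_sum,
          Fintype.sum_equiv (Equiv.inv H) (fun h => ρ (h⁻¹ : H) v) (fun h : H => ρ h v)
            (fun h => rfl), hsum, map_zero]
      rintro _ ⟨w, rfl⟩
      exact LinearMap.congr_fun this w
    · intro w hw
      obtain ⟨f, hf, rfl⟩ := exists_invariant_eq_sum_indTriv_mk K w
      refine sum_indTriv_mk_mem_range K H f (hker f hf ?_)
      rw [LinearMap.mem_ker, map_sum] at hw
      simpa only [hT, IntertwiningMap.toLinearMap_apply, indTrivLift_mk] using hw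
  let e : (IndV K.subtype (trivial ℂ K ℂ) ⧸ (indTrivMap K H).range.toSubmodule) ≃ₗ[ℂ]
      (ρ.orbitSpan v).toSubmodule :=
    Submodule.quotEquivOfEq _ _ hk ≪≫ₗ T.toLinearMap.quotKerEquivRange ≪≫ₗ
      LinearEquiv.ofEq _ _ (range_indTrivLift K ρ v hv)
  refine ⟨(Equiv.mk e fun g => ?_).symm⟩
  refine LinearMap.ext fun w => ?_
  obtain ⟨w, rfl⟩ := Submodule.mkQ_surjective _ w
  exact Subtype.ext (IntertwiningMap.isIntertwining _ _ T g w)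

end Induced

end Representation

/-! ### Crossed homomorphisms on free groups. -/

/-- Crossed homomorphisms out of a free group with arbitrary values on a basis. -/
theorem FreeGroupBasis.exists_crossedHom {ι F G M : Type*} [Group F] [Group G] [AddCommGroup M]
    [Module ℂ M] (b : FreeGroupBasis ι F) (φ : F →* G) (ρ : Representation ℂ G M) (m : ι → M) :
    ∃ δ : F → M, (∀ u w, δ (u * w) = δ u + ρ (φ u) (δ w)) ∧ ∀ i, δ (b i) = m i := by
  let α : G →* MulAut (Multiplicative M) :=
    { toFun g :=
        { toFun a := .ofAdd (ρ g a.toAdd)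
          invFun a := .ofAdd (ρ g⁻¹ a.toAdd)
          left_inv a := by simp
          right_inv a := by simp
          map_mul' a b := by simp }
      map_one' := by ext a; simp
      map_mul' g h := by ext a; simp }
  -- A crossed homomorphism over `φ` is the left component of a homomorphism to `M ⋊ G` whose right
  -- component is `φ`, so the universal property of the basis applies.
  let ψ : F →* Multiplicative M ⋊[α] G := b.lift fun i => ⟨.ofAdd (m i), φ (b i)⟩
  have hψ (i) : ψ (b i) = ⟨.ofAdd (m i), φ (b i)⟩ := by simp [ψ]
  have hφ : SemidirectProduct.rightHom.comp ψ = φ := b.ext_hom _ _ fun i => by simp [hψ]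
  refine ⟨fun w => (ψ w).left.toAdd, fun u w => ?_, fun i => by simp [hψ]⟩
  have : (ψ u).right = φ u := DFunLike.congr_fun hφ u
  simp [SemidirectProduct.mul_left, this, α]

/-! ### Chains of lifted loops and their universal property. -/

namespace RegularCover

open CWGraph

variable {Y X : CWGraph} (p : RegularCover Y X) (y₀ : Y.V)

theorem proj_append (L M : List (Y.E × Bool)) : p.proj (L ++ M) = p.proj L ++ p.proj M :=
  List.map_append

theorem proj_invRev (L : List (Y.E × Bool)) :
    p.proj (FreeGroup.invRev L) = FreeGroup.invRev (p.proj L) := by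
  simp [proj, FreeGroup.invRev, Function.comp_def]

theorem map_onE_mk (L : List (Y.E × Bool)) :
    FreeGroup.map p.onE (FreeGroup.mk L) = FreeGroup.mk (p.proj L) := by
  simp [proj]

theorem chain_translate (g : p.Deck) (L : List (Y.E × Bool)) :
    (Y.chain (FreeGroup.mk (p.translate g L))).toAdd =
      p.chainRep g (Y.chain (FreeGroup.mk L)).toAdd := by
  induction L with
  | nil => simp [translate, ← FreeGroup.one_eq_mk]
  | cons a L ih =>
    have h (b : Y.E × Bool) (M) : FreeGroup.mk (b :: M) = FreeGroup.mk [b] * FreeGroup.mk M := rfl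
    have h' : p.translate g (a :: L) = (g.1.2 a.1, a.2) :: p.translate g L := rfl
    rw [h', h, h a, Y.chain.map_mul, Y.chain.map_mul, toAdd_mul, toAdd_mul, map_add, ih]
    obtain ⟨e, b⟩ := a
    cases b
    · simp only [chain, FreeGroup.lift_mk, List.map_cons, List.map_nil, List.prod_cons,
        List.prod_nil, cond_false, mul_one, toAdd_inv, toAdd_ofAdd, map_neg]
      simp [chainRep, Finsupp.mapDomain_single]
    · simp [chain, chainRep, Finsupp.mapDomain_single]

/-- The chain of the lift at `y₀` of a loop of the base. -/
noncomputable def liftChain (w : X.pi1 (p.onV y₀)) : Y.E →₀ ℂ :=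
  (Y.chain (FreeGroup.mk (p.phi_spec y₀ w).choose)).toAdd

variable {y₀}

theorem liftChain_eq {w : X.pi1 (p.onV y₀)} {L : List (Y.E × Bool)} {v : Y.V}
    (hL : Y.IsPath y₀ L v) (h : FreeGroup.mk (p.proj L) = w) :
    p.liftChain y₀ w = (Y.chain (FreeGroup.mk L)).toAdd := by
  obtain ⟨h1, h2⟩ := (p.phi_spec y₀ w).choose_spec
  rw [liftChain, (p.homotopy_lift h1 hL (h2.trans h.symm)).2]

theorem phi_eq {w : X.pi1 (p.onV y₀)} {L : List (Y.E × Bool)} {g : p.Deck}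
    (hL : Y.IsPath y₀ L (g.1.1 y₀)) (h : FreeGroup.mk (p.proj L) = w) : p.phi y₀ w = g := by
  obtain ⟨M, h1, h2⟩ := p.phi_spec y₀ w
  exact p.deck_unique h1 hL (h2.trans h.symm)

/-- The lift of `u * w` is the lift of `u` followed by the lift of `w` translated by `φ(u)`, which
starts where the former ends. -/
theorem liftChain_mul (u w : X.pi1 (p.onV y₀)) : p.liftChain y₀ (u * w) =
    p.liftChain y₀ u + p.chainRep (p.phi y₀ u) (p.liftChain y₀ w) := by
  obtain ⟨L, hL, hL'⟩ := p.phi_spec y₀ u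
  obtain ⟨M, hM, hM'⟩ := p.phi_spec y₀ w
  rw [p.liftChain_eq hL hL', p.liftChain_eq hM hM', ← chain_translate,
    p.liftChain_eq (hL.append (p.isPath_translate _ hM)), ← FreeGroup.mul_mk, map_mul, toAdd_mul]
  rw [proj_append, proj_translate, ← FreeGroup.mul_mk, hL', hM']
  rfl

theorem coe_homologyClass_elevation (w : X.pi1 (p.onV y₀)) :
    (Y.homologyClass (p.elevation y₀ w) : Y.E →₀ ℂ) =
      p.liftChain y₀ (w ^ p.elevationDegree y₀ w) := by
  have h := (p.exists_elevation y₀ w).choose_spec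
  obtain ⟨L, hL, hL'⟩ := (p.elevation y₀ w).2
  rw [p.liftChain_eq hL]
  · rw [hL']; rfl
  · rw [← map_onE_mk, hL']
    exact h

/-- Every crossed homomorphism `π₁(X) → M` is the restriction of a `G`-map `C₁(Y) → M` to the
chains of lifts. -/
theorem exists_intertwiningMap {M : Type*} [AddCommGroup M] [Module ℂ M]
    (ρ : Representation ℂ p.Deck M) (δ : X.pi1 (p.onV y₀) → M)
    (hδ : ∀ u w, δ (u * w) = δ u + ρ (p.phi y₀ u) (δ w)) :
    ∃ D : Representation.IntertwiningMap p.chainRep ρ, ∀ w, D (p.liftChain y₀ w) = δ w := by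
  have hδ1 : δ 1 = 0 := by simpa using hδ 1 1
  -- A path `q v` from `y₀` to a chosen vertex `s v` over each `v`. These paths need not form a
  -- tree; only emptiness over the base point matters, and it is used at the end.
  have htree (v : X.V) : ∃ (q : List (Y.E × Bool)) (s : Y.V), Y.IsPath y₀ q s ∧ p.onV s = v ∧
      (v = p.onV y₀ → q = []) := by
    by_cases hv : v = p.onV y₀
    · exact ⟨[], y₀, rfl, hv.symm, fun _ => rfl⟩
    · obtain ⟨N, hN⟩ := p.connected_base.2 (p.onV y₀) v
      obtain ⟨L, s, hL, -, hs⟩ := p.path_lift hN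
      exact ⟨L, s, hL, hs, fun h => absurd h hv⟩
  choose q s hq hs hq0 using htree
  have hs0 : s (p.onV y₀) = y₀ := by
    have h := hq (p.onV y₀)
    rw [hq0 _ rfl] at h
    exact h.symm
  -- The chosen vertices represent the `G`-orbits, and `h y` is the group coordinate of `y` relative
  -- to them.
  have hcoord (y : Y.V) : ∃ h : p.Deck, h.1.1 (s (p.onV y)) = y := p.regular _ _ (hs _)
  choose h hh using hcoord
  have hh0 : h y₀ = 1 := p.deck_ext y₀ (by
    have := hh y₀
    rw [hs0] at this
    exact this)
  have hhg (g : p.Deck) (y : Y.V) : h (g.1.1 y) = g * h y := p.deck_ext (s (p.onV y)) (by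
    have h1 := hh (g.1.1 y)
    rw [g.2.2.2.1] at h1
    rw [h1]
    change _ = g.1.1 ((h y).1.1 _)
    rw [hh])
  -- Closing up the projection of `L` with the chosen paths gives a loop in `X`. Its lift at `y₀`
  -- runs along `q`, then `(h y)⁻¹ L`, then back along the translate of the other `q` by `(h y)⁻¹ h
  -- y'`; its end point gives `φ`.
  have hloop {y y' : Y.V} {L : List (Y.E × Bool)} (hL : Y.IsPath y L y') :
      ∃ w : X.pi1 (p.onV y₀), (w : FreeGroup X.E) = FreeGroup.mk (p.proj (q (p.onV y))) *
        FreeGroup.mk (p.proj L) * (FreeGroup.mk (p.proj (q (p.onV y'))))⁻¹ ∧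
        p.phi y₀ w = (h y)⁻¹ * h y' := by
    have hy : (h y)⁻¹.1.1 y = s (p.onV y) := by
      nth_rw 2 [← hh y]
      exact (h y).1.1.symm_apply_apply _
    have h1 := p.isPath_translate (h y)⁻¹ hL
    have h2 := p.isPath_translate ((h y)⁻¹ * h y') (hq (p.onV y')).invRev
    have h3 : ((h y)⁻¹ * h y').1.1 (s (p.onV y')) = (h y)⁻¹.1.1 y' := by
      change (h y)⁻¹.1.1 ((h y').1.1 _) = _
      rw [hh]
    rw [hy] at h1
    rw [h3] at h2
    have h4 := (hq (p.onV y)).append (h1.append h2)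
    have h5 := p.isPath_proj h4
    rw [show p.onV (((h y)⁻¹ * h y').1.1 y₀) = p.onV y₀ from ((h y)⁻¹ * h y').2.2.2.1 y₀] at h5
    refine ⟨⟨_, _, h5, rfl⟩, ?_, p.phi_eq h4 rfl⟩
    simp only [proj_append, proj_translate, proj_invRev, ← FreeGroup.mul_mk, ← FreeGroup.inv_mk,
      mul_assoc]
  have hedge (e : Y.E) : Y.IsPath (Y.src e) [(e, true)] (Y.tgt e) := ⟨rfl, rfl⟩
  choose l hl hlφ using fun e => hloop (hedge e)
  -- Equivariance forces the factor `h (Y.src e)`: the loop `l e` depends only on the image of `e`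
  -- in `X`.
  let D := Finsupp.linearCombination ℂ fun e => ρ (h (Y.src e)) (δ (l e))
  -- Along a path the connecting paths cancel in the product of the edge loops, and the crossed rule
  -- for `δ` supplies the successive factors `h`.
  have hpath (L : List (Y.E × Bool)) : ∀ y y', Y.IsPath y L y' → ∀ w : X.pi1 (p.onV y₀),
      (w : FreeGroup X.E) = FreeGroup.mk (p.proj (q (p.onV y))) *
        FreeGroup.mk (p.proj L) * (FreeGroup.mk (p.proj (q (p.onV y'))))⁻¹ →
      D (Y.chain (FreeGroup.mk L)).toAdd = ρ (h y) (δ w) := by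
    induction L with
    | nil =>
      rintro y _ rfl w hw
      have : w = 1 := Subtype.ext (hw.trans (mul_inv_eq_one.2 (mul_one _)))
      rw [this, hδ1, map_zero, ← FreeGroup.one_eq_mk, map_one, toAdd_one, map_zero]
    | cons a L ih =>
      rintro y y' ⟨hy, hL⟩ w hw
      have ha : Y.IsPath y [a] (Y.term a) := ⟨hy, rfl⟩
      obtain ⟨u, hu, huφ⟩ := hloop ha
      obtain ⟨w', hw', -⟩ := hloop hL
      have hcons : FreeGroup.mk (p.proj (a :: L)) =
        FreeGroup.mk (p.proj [a]) * FreeGroup.mk (p.proj L) := rfl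
      have huw : w = u * w' := Subtype.ext (by
        rw [hw, Subgroup.coe_mul, hu, hw', hcons]
        group)
      have hDa : D (Y.chain (FreeGroup.mk [a])).toAdd = ρ (h y) (δ u) := by
        obtain ⟨e, b⟩ := a
        cases b
        · obtain rfl : Y.tgt e = y := hy
          -- A reversed edge gives the inverse loop, and `δ 1 = 0` converts this into the sign of
          -- the chain.
          have hinv : u * l e = 1 := Subtype.ext (by
            rw [Subgroup.coe_mul, hu, hl]
            have h6 : FreeGroup.mk (p.proj [(e, false)]) =
              (FreeGroup.mk (p.proj [(e, true)]))⁻¹ := rfl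
            rw [h6]
            change _ * (FreeGroup.mk (p.proj (q (p.onV (Y.src e)))))⁻¹ * _ = _
            rw [Subgroup.coe_one]
            group)
          have h7 := hδ u (l e)
          rw [hinv, hδ1, huφ] at h7
          rw [eq_neg_of_add_eq_zero_left h7.symm, map_neg, ← Module.End.mul_apply, ← map_mul,
            mul_inv_cancel_left]
          simp [D, chain, CWGraph.term]
        · obtain rfl : Y.src e = y := hy
          have : u = l e := Subtype.ext (hu.trans (hl e).symm)
          simp [D, chain, this]
      have hcons' : FreeGroup.mk (a :: L) = FreeGroup.mk [a] * FreeGroup.mk L := rfl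
      rw [hcons', map_mul, toAdd_mul, map_add, hDa, ih _ _ hL w' hw', huw, hδ, huφ, map_add,
        ← Module.End.mul_apply, ← map_mul, mul_inv_cancel_left]
  refine ⟨⟨D, fun g => ?_⟩, fun w => ?_⟩
  · ext e
    have hle : l (g.1.2 e) = l e := Subtype.ext (by
      rw [hl, hl, g.2.1, g.2.2.1, g.2.2.2.1, g.2.2.2.1]
      simp [proj, g.2.2.2.2])
    simp [D, chainRep, Finsupp.mapDomain_single, g.2.1, hhg, hle]
  · obtain ⟨L, hL, hL'⟩ := p.phi_spec y₀ w
    rw [p.liftChain_eq hL hL']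
    refine (hpath L _ _ hL w ?_).trans (by rw [hh0, map_one]; rfl)
    rw [(p.phi y₀ w).2.2.2.1, hL', hq0 _ rfl]
    simp [proj, ← FreeGroup.one_eq_mk]

end RegularCover

/-! ### Fox calculus of a commutator and sums over the group. -/

namespace Representation

variable {F G M : Type*} [Group F] [Group G] [AddCommGroup M] [Module ℂ M]

theorem crossedHom_pow {φ : F →* G} {ρ : Representation ℂ G M} {δ : F → M}
    (hδ : ∀ u w, δ (u * w) = δ u + ρ (φ u) (δ w)) (w : F) (k : ℕ) :
    δ (w ^ k) = ∑ m ∈ Finset.range k, ρ (φ w ^ m) (δ w) := by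
  induction k with
  | zero => simpa using hδ 1 1
  | succ k ih => rw [pow_succ, hδ, ih, Finset.sum_range_succ, map_pow]

/-- Apply the crossed rule to both sides of `s t = ⁅s, t⁆ (t s)`. -/
theorem crossedHom_commutator {φ : F →* G} {ρ : Representation ℂ G M} {δ : F → M}
    (hδ : ∀ u w, δ (u * w) = δ u + ρ (φ u) (δ w)) (s t : F) :
    δ ⁅s, t⁆ = δ s + ρ (φ s) (δ t) - ρ (φ ⁅s, t⁆) (δ t + ρ (φ t) (δ s)) := by
  rw [← hδ t s, ← hδ s t, eq_sub_iff_add_eq, ← hδ]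
  congr 1
  group

theorem sum_range_pow_apply {g : G} {k : ℕ} (hk : g ^ k = 1) (ρ : Representation ℂ G M) (z : M) :
    ∑ m ∈ Finset.range k, ρ (g ^ (m + 1)) z = ∑ m ∈ Finset.range k, ρ (g ^ m) z := by
  have h := Finset.sum_range_succ' (fun m => ρ (g ^ m) z) k
  rw [Finset.sum_range_succ, hk, pow_zero] at h
  exact (add_right_cancel h).symm

/-- The Fox calculus expression of a power of a commutator that `φ` kills. -/
theorem crossedHom_commutator_pow {φ : F →* G} {ρ : Representation ℂ G M} {δ : F → M}
    (hδ : ∀ u w, δ (u * w) = δ u + ρ (φ u) (δ w)) (s t : F) {k : ℕ} (hk : φ ⁅s, t⁆ ^ k = 1) :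
    δ (⁅s, t⁆ ^ k) = ∑ m ∈ Finset.range k, ρ (φ ⁅s, t⁆ ^ m)
      ((ρ (φ s) (δ t) - δ t) - (ρ (φ t) (δ s) - δ s)) := by
  -- The subtracted term of the commutator formula carries an extra factor `φ ⁅s, t⁆`; summed over a
  -- full period, it is absorbed by the cyclic shift.
  have h := sum_range_pow_apply hk ρ (δ t + ρ (φ t) (δ s))
  have h1 : (ρ (φ s) (δ t) - δ t) - (ρ (φ t) (δ s) - δ s) =
    δ s + ρ (φ s) (δ t) - (δ t + ρ (φ t) (δ s)) := by abel
  simp_rw [crossedHom_pow hδ, h1, map_sub, Finset.sum_sub_distrib]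
  rw [← h, ← Finset.sum_sub_distrib]
  refine Finset.sum_congr rfl fun m _ => ?_
  rw [crossedHom_commutator hδ, map_sub, pow_succ, map_mul, Module.End.mul_apply]

theorem apply_eq_self_of_mem_closure (ρ : Representation ℂ G M) {S : Set G} {v : M}
    (hS : ∀ g ∈ S, ρ g v = v) {g : G} (hg : g ∈ Subgroup.closure S) : ρ g v = v := by
  induction hg using Subgroup.closure_induction with
  | mem g hg => exact hS g hg
  | one => simp
  | mul g h _ _ hg hh => rw [map_mul, Module.End.mul_apply, hh, hg]
  | inv g _ hg => nth_rw 1 [← hg]; simp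

theorem sum_apply_apply (H : Subgroup G) [Fintype H] (ρ : Representation ℂ G M) {g : G}
    (hg : g ∈ H) (z : M) : ∑ h : H, ρ h (ρ g z) = ∑ h : H, ρ h z :=
  Fintype.sum_equiv (Equiv.mulRight (⟨g, hg⟩ : H)) _ _ fun h => by simp

theorem sum_smul_apply_inv_apply [Fintype G] (ρ : Representation ℂ G M) {f : G → ℂ} {g : G}
    (hf : ∀ x, f (g * x) = f x) (z : M) :
    ∑ x, f x • ρ x⁻¹ (ρ g z) = ∑ x, f x • ρ x⁻¹ z :=
  Fintype.sum_equiv (Equiv.mulLeft g⁻¹) _ _ fun x => by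
    rw [Equiv.coe_mulLeft, ← hf (g⁻¹ * x), mul_inv_cancel_left, mul_inv_rev, inv_inv, map_mul,
      Module.End.mul_apply]

/-- Compare coefficients at `x⁻¹`: the term `y⁻¹ g` hits it exactly for `y = g x`, the term `y⁻¹`
for `y = x`. -/
theorem invariant_of_sum_leftRegular_eq_zero [Fintype G] {f : G → ℂ} {g : G}
    (h : ∑ x, f x • leftRegular ℂ G x⁻¹
      (leftRegular ℂ G g (MonoidAlgebra.single 1 1) - MonoidAlgebra.single 1 1) = 0) (x : G) :
    f (g * x) = f x := by
  classical
  simp_rw [map_sub, smul_sub, Finset.sum_sub_distrib, sub_eq_zero] at h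
  have h1 := congrArg (fun c : MonoidAlgebra ℂ G => c.coeff x⁻¹) h
  simp only [MonoidAlgebra.coeff_sum, Finsupp.finsetSum_apply, MonoidAlgebra.coeff_smul,
    ofMulAction_single, MonoidAlgebra.coeff_single, Finsupp.smul_apply, Finsupp.single_apply] at h1
  simp only [smul_eq_mul, mul_one, inv_inj] at h1
  have h2 (y : G) : y⁻¹ * g = x⁻¹ ↔ y = g * x := by
    rw [inv_mul_eq_iff_eq_mul, eq_mul_inv_iff_mul_eq, eq_comm]
  simpa [h2] using h1

end Representation

/-! ### The span of the elevation of a commutator. -/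

open Representation in
/-- A finite regular cover of finite connected graphs with deck group `G`, an arbitrary free basis
`x` of the fundamental group of the base, and the preferred elevation of `[x i, x j]`. -/
theorem proposition1p2 {X Y : CWGraph} [Finite X.V] [Finite X.E] [Finite Y.V] [Finite Y.E]
    (p : RegularCover Y X) (y₀ : Y.V) {n : ℕ} (hn : 2 ≤ n)
    (x : FreeGroupBasis (Fin n) (X.pi1 (p.onV y₀))) (i j : Fin n) (hij : i ≠ j)
    (K H : Subgroup p.Deck)
    (hK : K = Subgroup.closure {p.phi y₀ ⁅x i, x j⁆})
    (hH : H = Subgroup.closure {p.phi y₀ (x i), p.phi y₀ (x j)}) :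
    K ≤ H ∧ Function.Injective (Representation.indTrivMap K H) ∧
      Nonempty (Representation.Equiv
        (p.homologyRep.orbitSpan (Y.homologyClass (p.elevation y₀ ⁅x i, x j⁆))).toRepresentation
        ((Representation.indTriv K).quotient (Representation.indTrivMap K H).range.toSubmodule
          (Representation.indTrivMap K H).range.apply_mem_toSubmodule)) := by
  have := Fintype.ofFinite p.Deck
  have := Fintype.ofFinite H
  set s := x i with hs
  set t := x j with ht
  set a := p.phi y₀ s with ha
  set b := p.phi y₀ t with hb
  set g := p.phi y₀ ⁅s, t⁆ with hg
  set k := p.elevationDegree y₀ ⁅s, t⁆ with hkdef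
  have haH : a ∈ H := hH ▸ Subgroup.subset_closure (by simp)
  have hbH : b ∈ H := hH ▸ Subgroup.subset_closure (by simp)
  have hgab : g = a * b * a⁻¹ * b⁻¹ := by
    rw [hg, map_commutatorElement, commutatorElement_def]
  have hgH : g ∈ H :=
    hgab ▸ mul_mem (mul_mem (mul_mem haH hbH) (inv_mem haH)) (inv_mem hbH)
  have hgK : g ∈ K := hK ▸ Subgroup.subset_closure rfl
  have hKH : K ≤ H := by
    rw [hK, Subgroup.closure_le]
    exact Set.singleton_subset_iff.2 hgH
  obtain ⟨hk0, hk⟩ : 0 < k ∧ g ^ k = 1 := by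
    -- The deck group is finite, so the order of `g` lies in this set and the infimum is attained
    -- rather than being the default `0`.
    have h : k ∈ {k : ℕ | 0 < k ∧ ⁅s, t⁆ ^ k ∈ (p.phi y₀).ker} :=
      Nat.sInf_mem ⟨orderOf g, orderOf_pos g, by
        rw [MonoidHom.mem_ker, map_pow, ← hg, pow_orderOf_eq_one]⟩
    exact ⟨h.1, by rw [hg, ← map_pow]; exact MonoidHom.mem_ker.1 h.2⟩
  have hkC : (k : ℂ) ≠ 0 := Nat.cast_ne_zero.2 hk0.ne'
  set v := Y.homologyClass (p.elevation y₀ ⁅s, t⁆) with hvdef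
  have hv0 : (v : Y.E →₀ ℂ) = p.liftChain y₀ (⁅s, t⁆ ^ k) := p.coe_homologyClass_elevation _
  have hv1 := hv0.trans (crossedHom_commutator_pow p.liftChain_mul s t hk)
  refine ⟨hKH, indTrivMap_injective hKH, nonempty_orbitSpan_equiv K H _ v ?_ ?_ ?_⟩
  · intro h hh
    rw [hK] at hh
    refine apply_eq_self_of_mem_closure (M := Y.H1) p.homologyRep ?_ hh
    rintro _ rfl
    refine Subtype.ext ?_
    change p.chainRep g (v : Y.E →₀ ℂ) = v
    rw [hv1, map_sum, ← sum_range_pow_apply hk]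
    refine Finset.sum_congr rfl fun m _ => ?_
    rw [pow_succ', map_mul, Module.End.mul_apply]
  -- The norm element of `H` absorbs `g ^ m`, `a` and `b`, so each difference `(a - 1)` and `(b -
  -- 1)` dies.
  · refine Subtype.ext ?_
    rw [AddSubmonoidClass.coe_finsetSum]
    change ∑ h : H, p.chainRep h (v : Y.E →₀ ℂ) = 0
    simp_rw [hv1, map_sum]
    rw [Finset.sum_comm]
    refine Finset.sum_eq_zero fun m _ => ?_
    rw [sum_apply_apply H _ (pow_mem hgH m)]
    simp_rw [map_sub, Finset.sum_sub_distrib]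
    rw [sum_apply_apply H _ haH, sum_apply_apply H _ hbH, sub_self, sub_self, sub_self]
  · intro f hf h0
    have hfg (m : ℕ) : ∀ y, f (g ^ m * y) = f y := hf _ (pow_mem hgK m)
    have h1 : ∑ y, f y • p.chainRep y⁻¹ (p.liftChain y₀ (⁅s, t⁆ ^ k)) = 0 := by
      rw [← hv0]
      have := congrArg (Subtype.val : Y.H1 → _) h0
      rwa [AddSubmonoidClass.coe_finsetSum] at this
    -- Pushing the relation to `ℂ[G]` along `D` replaces `λ` by `δ`. As `f` is invariant under `g`,
    -- all `k` summands of the Fox formula agree, and `k ≠ 0` can be cancelled.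
    have key (δ : X.pi1 (p.onV y₀) → MonoidAlgebra ℂ p.Deck)
        (hδ : ∀ u w, δ (u * w) = δ u + leftRegular ℂ p.Deck (p.phi y₀ u) (δ w)) :
        ∑ y, f y • leftRegular ℂ p.Deck y⁻¹ ((leftRegular ℂ p.Deck a (δ t) - δ t) -
          (leftRegular ℂ p.Deck b (δ s) - δ s)) = 0 := by
      obtain ⟨D, hD⟩ := p.exists_intertwiningMap _ δ hδ
      have h2 := congrArg D h1
      simp_rw [map_sum, map_smul, IntertwiningMap.isIntertwining _ _ D, hD, map_zero,
        crossedHom_commutator_pow hδ s t hk, map_sum, Finset.smul_sum] at h2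
      rw [Finset.sum_comm,
        Finset.sum_congr rfl fun m _ => sum_smul_apply_inv_apply _ (hfg m) _, Finset.sum_const,
        Finset.card_range, ← Nat.cast_smul_eq_nsmul ℂ] at h2
      exact (smul_eq_zero.1 h2).resolve_left hkC
    have hfa : ∀ y, f (a * y) = f y := by
      obtain ⟨δ, hδ, hδx⟩ := x.exists_crossedHom (p.phi y₀) (leftRegular ℂ p.Deck)
        -- With `δ t = 1` and `δ s = 0`, which is consistent because `i ≠ j`, only the term `a - 1`
        -- survives.
        (Pi.single j (MonoidAlgebra.single 1 1))
      have h2 := key δ hδ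
      rw [hs, ht, hδx, hδx, Pi.single_eq_same, Pi.single_eq_of_ne hij, map_zero, sub_zero,
        sub_zero] at h2
      exact invariant_of_sum_leftRegular_eq_zero h2
    have hfb : ∀ y, f (b * y) = f y := by
      obtain ⟨δ, hδ, hδx⟩ := x.exists_crossedHom (p.phi y₀) (leftRegular ℂ p.Deck)
        (Pi.single i (MonoidAlgebra.single 1 1))
      have h2 := key δ hδ
      rw [hs, ht, hδx, hδx, Pi.single_eq_same, Pi.single_eq_of_ne hij.symm, map_zero, sub_zero,
        zero_sub] at h2
      simp_rw [map_neg, smul_neg, Finset.sum_neg_distrib, neg_eq_zero] at h2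
      exact invariant_of_sum_leftRegular_eq_zero h2
    intro h hh
    rw [hH] at hh
    induction hh using Subgroup.closure_induction with
    | mem h hh =>
      rcases hh with rfl | rfl
      · exact hfa
      · exact hfb
    | one => simp
    | mul h h' _ _ ih ih' => intro y; rw [mul_assoc, ih, ih']
    | inv h _ ih => intro y; rw [← ih, mul_inv_cancel_left]
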